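/- Let $G=(V,E)$ be a finite simple graph. A consistent path system $\mathcal P$ in $G$ is a choice, for every $u,v\in V$, of a simple path $P_{u,v}$ between $u$ and $v$ in $G$, with $P_{u,v}=P_{v,u}$ (up to orientation), such that whenever a vertex $a$ lies on $P_{u,v}$, the path $P_{u,v}$ is the concatenation of $P_{u,a}$ and $P_{a,v}$. It is neighborly if $P_{u,v}$ is the edge $uv$ for every $uv\in E$, and strictly metric if there is a weight function $w:E\to\mathbb R_{>0}$ such that every $P_{u,v}$ is the unique $w$-shortest path between $u$ and $v$. Let $\mathscr{NS}(G)$ be the set of neighborly strictly metric path systems in $G$. For $m\ge 0$ let $\mathcal J_m$ be the graph on $2m$ vertices $x_1,\dots,x_m,y_1,\dots,y_m$ in which two distinct vertices are adjacent unless both belong to $\{x_1,\dots,x_m\}$. A neighborly consistent path system in $\mathcal J_m$ is called monotone if for all $i\ne j$ there is $k_{ij}\in\{1,\dots,m\}$ with $P_{x_i,x_j}=x_i\,y_{k_{ij}}\,x_j$, and $k_{ij}\le k_{ik}$ whenever $j\le k$ and $i\notin\{j,k\}$. **Proposition.** Let $\alpha=\frac{3}{16}\,(3\log_2 3-4)$;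 then $\alpha\approx 0.141$, that is, $|\alpha-0.141|<0.001$. As $n\to\infty$ through the even integers, the number of monotone path systems in the $n$-vertex graph $\mathcal J_{n/2}$ is $$2^{\alpha n^2(1+o(1))},$$ and $$|\mathscr{NS}(\mathcal J_{n/2})|\ \ge\ 2^{\alpha n^2(1+o(1))}.$$ -/

import Mathlib

open Filter Topology

/-- A consistent path system in a graph `G`: one simple path `P_{u,v}` for every pair of vertices
(with `P_{v,u}` the path `P_{u,v}` traversed backwards), such that whenever `a` lies on `P_{u,v}`,
the path `P_{u,v}` is the concatenation of `P_{u,a}` and `P_{a,v}`. -/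
@[ext] structure ConsistentPathSystem {V : Type*} (G : SimpleGraph V) where
  path : ∀ u v : V, G.Path u v
  symm : ∀ u v : V, (path v u).1 = (path u v).1.reverse
  consistent : ∀ u v a : V, a ∈ (path u v).1.support →
    (path u v).1 = (path u a).1.append (path a v).1

namespace ConsistentPathSystem

variable {V : Type*} {G : SimpleGraph V}

/-- The path chosen between the ends of an edge is that edge. -/
def IsNeighborly (P : ConsistentPathSystem G) : Prop :=
  ∀ u v : V, ∀ h : G.Adj u v, (P.path u v).1 = h.toWalk

/-- Some assignment of positive weights to the edges makes every path of the system the unique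
lightest path between its ends. (The values of `w` outside the edge set play no role.) -/
def IsStrictlyMetric (P : ConsistentPathSystem G) : Prop :=
  ∃ w : Sym2 V → ℝ, (∀ e ∈ G.edgeSet, 0 < w e) ∧
    ∀ u v : V, ∀ q : G.Path u v, q ≠ P.path u v →
      ((P.path u v).1.edges.map w).sum < (q.1.edges.map w).sum

end ConsistentPathSystem

/-- The set of neighborly strictly metric path systems in `G`. -/
def neighborlyStrictlyMetric {V : Type*} (G : SimpleGraph V) : Set (ConsistentPathSystem G) :=
  {P | P.IsNeighborly ∧ P.IsStrictlyMetric}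

/-- The join of an anti-clique on `x_1, …, x_m` (left summand) and a clique on `y_1, …, y_m`
(right summand): two distinct vertices are adjacent unless both are `x`'s. -/
def graphJ (m : ℕ) : SimpleGraph (Fin m ⊕ Fin m) where
  Adj u v := u ≠ v ∧ ¬ (u.isLeft ∧ v.isLeft)
  symm := ⟨fun _ _ h => ⟨h.1.symm, fun h' => h.2 h'.symm⟩⟩
  loopless := ⟨fun _ h => h.1 rfl⟩

/-- The monotone path systems in `graphJ m`: the neighborly ones with
`P_{x_i x_j} = x_i y_{M i j} x_j` for all `i ≠ j`, where the rows of the matrix `M`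
are non-decreasing once the diagonal entry is ignored. (Off the diagonal `M` is determined by `P`,
and symmetric; the diagonal of `M` is unconstrained.) -/
def monotonePathSystems (m : ℕ) : Set (ConsistentPathSystem (graphJ m)) :=
  {P | P.IsNeighborly ∧ ∃ M : Fin m → Fin m → Fin m,
    (∀ i j, i ≠ j → (P.path (Sum.inl i) (Sum.inl j)).1.support =
      [Sum.inl i, Sum.inr (M i j), Sum.inl j]) ∧
    ∀ i j k, i ≠ j → i ≠ k → j ≤ k → M i j ≤ M i k}

/-! Since edges are their own paths, a monotone system in $\mathcal J_{r+1}$ is a symmetric matrix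
$M$ off the diagonal, with non-decreasing rows. Adding $i$ to the entries $M_{ij}$, $i<j$, turns the
superdiagonals into the rows of a strict Gelfand–Tsetlin pattern with $r$ rows and top entries below
$2r$, and this is a bijection (`ncard_monotonePathSystems_succ`). The patterns with top row $l$
number $\det\binom{l_i}{j}$, a Vandermonde product over a superfactorial
(`card_interlacingPatterns`).

The sum of these determinants over all $l$ is awkward, but the sum of their squares has a closed
form (`sum_binomialDet_sq`). There are at most $(2r)^r=2^{o(r^2)}$ top rows, so the square of the
sum and the sum of squares agree up to a factor $2^{o(r^2)}$. With $S(r)=\sum_{k<r}\log k!$, the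
logarithm of the closed form is $S(3r)-3S(2r)+3S(r)$ up to $O(r\log r)$, and
$S(x)\approx\frac{x^2}{2}\log x-\frac34x^2$ gives the constant.

For the second bound, every monotone system is strictly metric (`monotonePathSystems_subset`):
counting the entries of each row of $M$ up to a threshold yields potentials $f_i$ such that
$f_i+f_j$ has its unique minimum at $M_{ij}$. These perturb a large constant weight. -/

/-! ### Binomial determinants and Vandermonde products -/

/-- The determinant of the matrix of binomial coefficients `(l i).choose j`. -/
noncomputable def binomialDet {n : ℕ} (l : Fin n → ℕ) : ℝ :=
  (Matrix.of fun i j : Fin n => ((l i).choose j : ℝ)).det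

theorem sum_Ico_choose_eq_sub {a b : ℕ} (h : a ≤ b) (j : ℕ) :
    ∑ x ∈ Finset.Ico a b, (x.choose j : ℝ) = (b.choose (j + 1) : ℝ) - a.choose (j + 1) := by
  induction b, h using Nat.le_induction with
  | base => simp
  | succ b hb ih =>
    rw [Finset.sum_Ico_succ_top hb, ih, Nat.choose_succ_succ' b j]
    push_cast; ring

/-- Summing the binomial determinant over all sequences interlacing `l`. -/
theorem sum_binomialDet_interlacing {n : ℕ} (l : Fin (n + 1) → ℕ) (hl : Monotone l) :
    ∑ k ∈ Fintype.piFinset (fun i : Fin n => Finset.Ico (l i.castSucc) (l i.succ)),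
      binomialDet k = binomialDet l := by
  have h1 := (Matrix.detRowAlternating (n := Fin n) (R := ℝ)).toMultilinearMap.map_sum_finset
    (fun (_ : Fin n) (x : ℕ) (j : Fin n) => (x.choose j : ℝ))
    (fun i : Fin n => Finset.Ico (l i.castSucc) (l i.succ))
  change _ = ∑ k ∈ _, binomialDet k at h1
  rw [← h1]
  -- Subtracting from each row its predecessor leaves $(1,0,\dots,0)^T$ as first column. The
  -- remaining minor has entries $\binom{l_{i+1}}{j+1}-\binom{l_i}{j+1}$, each a hockey-stick sum;
  -- multilinearity in the rows pulls the sums out.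
  have h2 : binomialDet l = (Matrix.of fun i j : Fin (n + 1) =>
      Fin.cases ((l 0).choose j : ℝ)
        (fun i' => ((l i'.succ).choose j : ℝ) - (l i'.castSucc).choose j) i).det := by
    refine Matrix.det_eq_of_forall_row_eq_smul_add_pred (fun _ => 1) ?_ ?_
    · intro j; simp
    · intro i j; simp
  rw [h2, Matrix.det_succ_column_zero, Fin.sum_univ_succ]
  simp only [Matrix.of_apply, Fin.cases_zero, Fin.cases_succ, Fin.val_zero, Nat.choose_zero_right,
    Nat.cast_one, sub_self, mul_zero, zero_mul, Finset.sum_const_zero, add_zero, pow_zero, mul_one,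
    one_mul]
  change Matrix.det _ = _
  congr 1
  ext i j
  simp only [Matrix.submatrix_apply, Matrix.of_apply, Fin.succAbove_zero, Fin.cases_succ,
    Finset.sum_apply]
  rw [sum_Ico_choose_eq_sub (hl (Fin.castSucc_le_succ i))]
  simp

/-- $j!\binom{x}{j}$ is the falling factorial, monic of degree $j$ in $x$. -/
theorem binomialDet_mul_prod_factorial {n : ℕ} (l : Fin n → ℕ) :
    (∏ j : Fin n, ((j : ℕ).factorial : ℝ)) * binomialDet l =
      (Matrix.vandermonde fun i => (l i : ℝ)).det := by
  rw [Matrix.det_eval_matrixOfPolynomials_eq_det_vandermonde _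
    (fun j : Fin n => descPochhammer ℝ j) (fun i => descPochhammer_natDegree _ _)
    (fun i => monic_descPochhammer _ _), binomialDet, ← Matrix.det_mul_row]
  congr 1
  ext i j
  simp only [Matrix.of_apply]
  rw [descPochhammer_eval_eq_descFactorial, Nat.descFactorial_eq_factorial_mul_choose]
  push_cast; ring

/-- $j!\binom{x+j}{j}$ is the rising factorial of $x+1$, again monic of degree $j$; the shift by 1
leaves the Vandermonde determinant unchanged. -/
theorem det_choose_add_mul_prod_factorial {n : ℕ} (x : Fin n → ℕ) :
    (∏ j : Fin n, ((j : ℕ).factorial : ℝ)) *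
      (Matrix.of fun i j : Fin n => ((x i + j).choose j : ℝ)).det =
      (Matrix.vandermonde fun i => (x i : ℝ)).det := by
  have h : (Matrix.vandermonde fun i => (x i : ℝ)).det =
      (Matrix.vandermonde fun i => ((x i : ℝ) + 1)).det := by
    rw [Matrix.det_vandermonde_add]
  rw [h, Matrix.det_eval_matrixOfPolynomials_eq_det_vandermonde _
    (fun j : Fin n => ascPochhammer ℝ j) (fun i => ascPochhammer_natDegree _ _)
    (fun i => monic_ascPochhammer _ _), ← Matrix.det_mul_row]
  congr 1
  ext i j
  simp only [Matrix.of_apply]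
  have := ascPochhammer_nat_eq_ascFactorial (x i + 1) j
  have h2 : (((ascPochhammer ℕ j).eval (x i + 1) : ℕ) : ℝ) = (ascPochhammer ℝ j).eval ((x i : ℝ) + 1) := by
    rw [← Nat.cast_succ, ascPochhammer_eval_cast]
  rw [← h2, this, Nat.ascFactorial_eq_factorial_mul_choose]
  push_cast; ring

theorem prod_factorial_pos (n : ℕ) : 0 < ∏ j : Fin n, ((j : ℕ).factorial : ℝ) :=
  Finset.prod_pos fun _ _ => by positivity

theorem binomialDet_nonneg {n : ℕ} {l : Fin n → ℕ} (hl : Monotone l) : 0 ≤ binomialDet l := by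
  have h := binomialDet_mul_prod_factorial l
  have h2 : 0 ≤ (Matrix.vandermonde fun i => (l i : ℝ)).det := by
    rw [Matrix.det_vandermonde]
    refine Finset.prod_nonneg fun i _ => Finset.prod_nonneg fun j hj => ?_
    have : l i ≤ l j := hl (Finset.mem_Ioi.1 hj).le
    rw [sub_nonneg]; exact_mod_cast this
  rw [← h] at h2
  exact nonneg_of_mul_nonneg_right h2 (prod_factorial_pos n)

/-- Reflecting the arguments changes the binomial determinant into its "rising" variant,
up to a sign that does not depend on the arguments. -/
theorem exists_sign_binomialDet (n M : ℕ) : ∃ s : ℝ, s * s = 1 ∧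
    ∀ l : Fin n → ℕ, (∀ i, l i < M) →
      (Matrix.of fun i j : Fin n => ((M - 1 - l i + j).choose j : ℝ)).det = s * binomialDet l := by
  -- One sign for each Vandermonde difference, all of which are negated by $x\mapsto M-1-x$.
  refine ⟨∏ i : Fin n, ∏ j ∈ Finset.Ioi i, (-1), ?_, ?_⟩
  · rw [← Finset.prod_mul_distrib]
    refine Finset.prod_eq_one fun i _ => ?_
    rw [← Finset.prod_mul_distrib]
    simp
  · intro l hl
    have h1 := binomialDet_mul_prod_factorial l
    have h2 := det_choose_add_mul_prod_factorial (fun i => M - 1 - l i)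
    refine mul_left_cancel₀ (prod_factorial_pos n).ne' ?_
    rw [h2, mul_left_comm, h1, Matrix.det_vandermonde, Matrix.det_vandermonde,
      ← Finset.prod_mul_distrib]
    refine Finset.prod_congr rfl fun i _ => ?_
    rw [← Finset.prod_mul_distrib]
    refine Finset.prod_congr rfl fun j _ => ?_
    have hi := hl i
    have hj := hl j
    have ei : ((M - 1 - l i : ℕ) : ℝ) = ((M - 1 : ℕ) : ℝ) - l i := Nat.cast_sub (by omega)
    have ej : ((M - 1 - l j : ℕ) : ℝ) = ((M - 1 : ℕ) : ℝ) - l j := Nat.cast_sub (by omega)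
    rw [ei, ej]
    ring

/-! ### The sum of squared determinants in closed form -/

/-- A form of the Andréief identity. -/
theorem sum_det_mul_det {n M : ℕ} (A B : ℕ → Fin n → ℝ) :
    ∑ l ∈ Fintype.piFinset (fun _ : Fin n => Finset.range M),
      (Matrix.of fun i j => A (l i) j).det * (Matrix.of fun i j => B (l i) j).det =
    n.factorial * (Matrix.of fun j k : Fin n => ∑ x ∈ Finset.range M, A x j * B x k).det := by
  -- Every term of the Leibniz expansion of $\det A$ contributes the same amount: permuting the rows
  -- by $\sigma$ cancels the sign.
  have key : ∀ σ : Equiv.Perm (Fin n),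
      ∑ l ∈ Fintype.piFinset (fun _ : Fin n => Finset.range M),
        ((Equiv.Perm.sign σ : ℤ) : ℝ) * (∏ i, A (l i) (σ i)) *
          (Matrix.of fun i j : Fin n => B (l i) j).det =
      (Matrix.of fun j k : Fin n => ∑ x ∈ Finset.range M, A x j * B x k).det := by
    intro σ
    have h1 := (Matrix.detRowAlternating (n := Fin n) (R := ℝ)).toMultilinearMap.map_sum_finset
      (fun (i : Fin n) (x : ℕ) (k : Fin n) => A x (σ i) * B x k)
      (fun _ : Fin n => Finset.range M)
    have h2 : ∀ l : Fin n → ℕ, (Matrix.of fun i j => A (l i) (σ i) * B (l i) j).det =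
        (∏ i, A (l i) (σ i)) * (Matrix.of fun i j => B (l i) j).det := fun l =>
      Matrix.det_mul_column (fun i => A (l i) (σ i)) (Matrix.of fun i j => B (l i) j)
    change _ = ∑ l ∈ Fintype.piFinset _, (Matrix.of fun i j : Fin n => A (l i) (σ i) * B (l i) j).det at h1
    simp_rw [mul_assoc, ← h2, ← Finset.mul_sum]
    rw [← h1]
    have h3 := Matrix.det_permute σ
      (Matrix.of fun j k : Fin n => ∑ x ∈ Finset.range M, A x j * B x k)
    have h4 : ((Matrix.of fun j k : Fin n => ∑ x ∈ Finset.range M, A x j * B x k).submatrix σ id) =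
        fun i => ∑ x ∈ Finset.range M, fun k => A x (σ i) * B x k := by
      ext i k; simp
    rw [h4] at h3
    change _ * Matrix.det _ = _
    rw [h3, ← mul_assoc, ← Int.cast_mul, ← Units.val_mul, Int.units_mul_self]
    simp
  have h5 : ∀ l : Fin n → ℕ, (Matrix.of fun i j => A (l i) j).det =
      ∑ σ : Equiv.Perm (Fin n), ((Equiv.Perm.sign σ : ℤ) : ℝ) * (∏ i, A (l i) (σ i)) := by
    intro l
    rw [← Matrix.det_transpose, Matrix.det_apply']
    rfl
  simp_rw [h5, Finset.sum_mul]
  rw [Finset.sum_comm]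
  simp_rw [key]
  simp [Fintype.card_perm]

/-- The $(j+k+1)$-subsets of $\{0,\dots,N\}$, sorted by their $(j+1)$-st smallest element $x$. -/
theorem sum_choose_mul_choose_sub (N j k : ℕ) :
    ∑ x ∈ Finset.range (N + 1), x.choose j * (N - x).choose k = (N + 1).choose (j + k + 1) := by
  induction N generalizing k with
  | zero =>
    rcases j with _ | j <;> rcases k with _ | k <;> simp [Nat.choose_eq_zero_of_lt]
  | succ N ih =>
    rw [Finset.sum_range_succ]
    cases k with
    | zero =>
      simp only [Nat.choose_zero_right, mul_one] at ih ⊢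
      have := ih 0
      simp only [Nat.choose_zero_right, mul_one] at this
      rw [this, add_zero, Nat.choose_succ_succ' (N + 1) j]
      ring
    | succ k =>
      have h : ∀ x ∈ Finset.range (N + 1), x.choose j * (N + 1 - x).choose (k + 1) =
          x.choose j * (N - x).choose k + x.choose j * (N - x).choose (k + 1) := by
        intro x hx
        rw [Finset.mem_range] at hx
        rw [show N + 1 - x = (N - x) + 1 by omega, Nat.choose_succ_succ' (N - x) k]
        ring
      rw [Finset.sum_congr rfl h, Finset.sum_add_distrib, ih, ih]
      simp only [Nat.sub_self, Nat.choose_zero_succ, mul_zero, add_zero]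
      rw [show j + (k + 1) + 1 = (j + k + 1) + 1 by ring, Nat.choose_succ_succ' (N + 1)]

theorem sum_choose_mul_choose_sub_add (M j k : ℕ) :
    ∑ x ∈ Finset.range M, x.choose j * (M - 1 - x + k).choose k = (M + k).choose (j + k + 1) := by
  rcases M with _ | M
  · simp [Nat.choose_eq_zero_of_lt (show k < j + k + 1 by omega)]
  · rw [show M + 1 + k = (M + k) + 1 by ring, ← sum_choose_mul_choose_sub,
      show M + k + 1 = (M + 1) + k by ring, Finset.sum_range_add _ (M + 1) k]
    rw [Finset.sum_eq_zero (s := Finset.range k), add_zero]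
    · refine Finset.sum_congr rfl fun x hx => ?_
      rw [Finset.mem_range] at hx
      congr 2
      omega
    · intro x hx
      rw [Finset.mem_range] at hx
      rw [Nat.choose_eq_zero_of_lt (show M + k - (M + 1 + x) < k by omega), mul_zero]

theorem abs_det_vandermonde_add (n a : ℕ) :
    |(Matrix.vandermonde fun i : Fin n => ((i : ℕ) : ℝ) + a).det| =
      ∏ j : Fin n, ((j : ℕ).factorial : ℝ) := by
  rw [Matrix.det_vandermonde_add]
  have h := binomialDet_mul_prod_factorial (fun i : Fin n => (i : ℕ))
  have h1 : binomialDet (fun i : Fin n => (i : ℕ)) = 1 := by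
    rw [binomialDet, Matrix.det_of_isLowerTriangular]
    · simp
    · intro i j hij
      simp only [Matrix.of_apply]
      rw [Nat.choose_eq_zero_of_lt (by simpa using hij)]; simp
  rw [← h, h1, mul_one, abs_of_pos (prod_factorial_pos n)]

/-- Row factors $1/(M-1-j)!$ and column factors $(M+k)!/(n+k)!$ come out. What remains are falling
factorials of $n+k$ of degree $n-1-j$: a Vandermonde determinant at consecutive nodes, with the
degrees reversed. -/
theorem abs_det_choose_add {n M : ℕ} (h : n ≤ M) :
    |(Matrix.of fun j k : Fin n => ((M + k).choose (j + k + 1) : ℝ)).det| =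
      ∏ k : Fin n, (((M + k).factorial : ℝ) * (k : ℕ).factorial /
        ((M - 1 - k).factorial * (n + k).factorial)) := by
  have e1 : (Matrix.of fun j k : Fin n => ((M + k).choose (j + k + 1) : ℝ)) =
      Matrix.of fun j k : Fin n => (((M - 1 - j).factorial : ℝ)⁻¹) *
        (Matrix.of fun j k : Fin n => ((M + k).factorial / (n + k).factorial : ℝ) *
          (Matrix.of fun j k : Fin n => ((n + k).descFactorial (n - 1 - j) : ℝ)) j k) j k := by
    ext j k
    simp only [Matrix.of_apply]
    have hj := j.2
    have hk := k.2
    have a1 := Nat.choose_mul_factorial_mul_factorial (show (j : ℕ) + k + 1 ≤ M + k by omega)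
    have a2 := Nat.factorial_mul_descFactorial (show n - 1 - (j : ℕ) ≤ n + k by omega)
    rw [show M + k - (j + k + 1) = M - 1 - j by omega] at a1
    rw [show n + k - (n - 1 - j) = j + k + 1 by omega] at a2
    rw [← a1, ← a2]
    push_cast
    have : (((j : ℕ) + k + 1).factorial : ℝ) ≠ 0 := by positivity
    have : ((M - 1 - (j : ℕ)).factorial : ℝ) ≠ 0 := by positivity
    have : ((n + (k : ℕ)).descFactorial (n - 1 - (j : ℕ)) : ℝ) ≠ 0 := by
      have := Nat.descFactorial_pos.2 (show n - 1 - (j : ℕ) ≤ n + k by omega)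
      positivity
    field_simp
  have e2 : |(Matrix.of fun j k : Fin n => ((n + k).descFactorial (n - 1 - j) : ℝ)).det| =
      ∏ j : Fin n, ((j : ℕ).factorial : ℝ) := by
    rw [← abs_det_vandermonde_add n n, Matrix.det_eval_matrixOfPolynomials_eq_det_vandermonde _
      (fun j : Fin n => descPochhammer ℝ j) (fun i => descPochhammer_natDegree _ _)
      (fun i => monic_descPochhammer _ _), ← Matrix.det_transpose,
      ← Matrix.abs_det_submatrix_equiv_equiv (Equiv.refl (Fin n)) Fin.revPerm]
    congr 2
    ext i j
    simp only [Matrix.submatrix_apply, Matrix.transpose_apply, Matrix.of_apply, Equiv.refl_apply,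
      Fin.revPerm_apply, Fin.val_rev]
    rw [← Nat.cast_add, descPochhammer_eval_eq_descFactorial]
    have := j.2
    congr 2
    · omega
    · omega
  rw [e1, Matrix.det_mul_column, Matrix.det_mul_row (fun k : Fin n =>
    ((M + k).factorial / (n + k).factorial : ℝ))
      (Matrix.of fun j k : Fin n => ((n + k).descFactorial (n - 1 - j) : ℝ)), abs_mul, abs_mul, e2,
    abs_of_pos (Finset.prod_pos fun _ _ => by positivity),
    abs_of_pos (Finset.prod_pos fun _ _ => by positivity),
    ← Finset.prod_mul_distrib, ← Finset.prod_mul_distrib]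
  refine Finset.prod_congr rfl fun k _ => ?_
  field_simp

/-- The sum of the squares of the binomial determinants over a cube. -/
theorem sum_binomialDet_sq {n M : ℕ} (h : n ≤ M) :
    ∑ l ∈ Fintype.piFinset (fun _ : Fin n => Finset.range M), binomialDet l ^ 2 =
      n.factorial * ∏ k : Fin n, (((M + k).factorial : ℝ) * (k : ℕ).factorial /
        ((M - 1 - k).factorial * (n + k).factorial)) := by
  obtain ⟨s, hs, hsign⟩ := exists_sign_binomialDet n M
  have h1 := sum_det_mul_det (n := n) (M := M) (fun x j => (x.choose j : ℝ))
    (fun x k => ((M - 1 - x + k).choose k : ℝ))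
  -- Reflecting one of the two equal factors turns each Andréief entry into a convolution that sums
  -- to a single binomial coefficient.
  have h2 : (Matrix.of fun j k : Fin n => ∑ x ∈ Finset.range M,
      (x.choose j : ℝ) * ((M - 1 - x + k).choose k : ℝ)) =
      Matrix.of fun j k : Fin n => ((M + k).choose (j + k + 1) : ℝ) := by
    ext j k
    simp only [Matrix.of_apply]
    exact_mod_cast sum_choose_mul_choose_sub_add M j k
  rw [h2] at h1
  have h3 : ∑ l ∈ Fintype.piFinset (fun _ : Fin n => Finset.range M),
      (Matrix.of fun i j : Fin n => ((l i).choose j : ℝ)).det *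
        (Matrix.of fun i j : Fin n => ((M - 1 - l i + j).choose j : ℝ)).det =
      s * ∑ l ∈ Fintype.piFinset (fun _ : Fin n => Finset.range M), binomialDet l ^ 2 := by
    rw [Finset.mul_sum]
    refine Finset.sum_congr rfl fun l hl => ?_
    rw [hsign l (fun i => by simpa using Fintype.mem_piFinset.1 hl i)]
    change binomialDet l * _ = _
    ring
  rw [h3] at h1
  have hs1 : |s| = 1 := by
    have : |s| * |s| = 1 := by rw [← abs_mul, hs, abs_one]
    nlinarith [abs_nonneg s]
  have h4 := congrArg abs h1
  rw [abs_mul, hs1, one_mul, abs_of_nonneg (Finset.sum_nonneg fun _ _ => sq_nonneg _), abs_mul,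
    abs_det_choose_add h, Nat.abs_cast] at h4
  exact h4

/-! ### Counting interlacing patterns -/

/-- Put the row `l` on top of the triangular array `a`. -/
def consRow {n : ℕ} (l : Fin n → ℕ) (a : ℕ → ℕ → ℕ) : ℕ → ℕ → ℕ
  | 0, i => if h : i < n then l ⟨i, h⟩ else 0
  | d + 1, i => a d i

open Classical in
/-- The strict Gelfand–Tsetlin patterns with top row `l`: triangular arrays in which each row
interlaces the row above it. -/
noncomputable def interlacingPatterns : ∀ n : ℕ, (Fin n → ℕ) → Finset (ℕ → ℕ → ℕ)
  | 0, _ => {fun _ _ => 0}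
  | n + 1, l =>
    (Fintype.piFinset fun i : Fin n => Finset.Ico (l i.castSucc) (l i.succ)).biUnion
      fun k => (interlacingPatterns n k).image (consRow l)

/-- Triangular arrays with `n` rows, extended by zero, in which consecutive rows interlace. -/
structure IsInterlacing (n : ℕ) (a : ℕ → ℕ → ℕ) : Prop where
  eq_zero : ∀ d i, n ≤ d + i → a d i = 0
  le : ∀ d i, d + i + 1 < n → a d i ≤ a (d + 1) i
  lt : ∀ d i, d + i + 1 < n → a (d + 1) i < a d (i + 1)

theorem mem_interlacingPatterns {n : ℕ} {l : Fin n → ℕ} {a : ℕ → ℕ → ℕ} :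
    a ∈ interlacingPatterns n l ↔ IsInterlacing n a ∧ ∀ i : Fin n, a 0 i = l i := by
  induction n generalizing a with
  | zero =>
    simp only [interlacingPatterns, Finset.mem_singleton, IsEmpty.forall_iff, and_true]
    constructor
    · rintro rfl
      exact ⟨fun _ _ _ => rfl, fun _ _ h => by omega, fun _ _ h => by omega⟩
    · intro h
      funext d i
      exact h.eq_zero d i (Nat.zero_le _)
  | succ n ih =>
    simp only [interlacingPatterns, Finset.mem_biUnion, Fintype.mem_piFinset, Finset.mem_Ico,
      Finset.mem_image, ih]
    constructor
    · rintro ⟨k, hk, b, ⟨hb, hb0⟩, rfl⟩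
      refine ⟨⟨?_, ?_, ?_⟩, ?_⟩
      · rintro (_ | d) i h
        · simp only [consRow]
          rw [dif_neg (by omega)]
        · exact hb.eq_zero d i (by omega)
      · rintro (_ | d) i h
        · have := (hk ⟨i, by omega⟩).1
          simp only [consRow]
          rw [dif_pos (show i < n + 1 by omega)]
          have h0 := hb0 ⟨i, by omega⟩
          simp only at h0
          rw [h0]
          exact this
        · exact hb.le d i (by omega)
      · rintro (_ | d) i h
        · have := (hk ⟨i, by omega⟩).2
          simp only [consRow]
          rw [dif_pos (show i + 1 < n + 1 by omega)]
          have h0 := hb0 ⟨i, by omega⟩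
          simp only at h0
          rw [h0]
          exact this
        · exact hb.lt d i (by omega)
      · intro i
        simp only [consRow]
        rw [dif_pos i.2]
    · rintro ⟨ha, ha0⟩
      refine ⟨fun i => a 1 i, fun i => ?_, fun d => a (d + 1), ⟨⟨?_, ?_, ?_⟩, fun i => rfl⟩, ?_⟩
      · rw [← ha0, ← ha0]
        exact ⟨ha.le 0 i (by have := i.2; omega), ha.lt 0 i (by have := i.2; omega)⟩
      · exact fun d i h => ha.eq_zero (d + 1) i (by omega)
      · exact fun d i h => ha.le (d + 1) i (by omega)
      · exact fun d i h => ha.lt (d + 1) i (by omega)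
      · funext d i
        rcases d with _ | d
        · simp only [consRow]
          split_ifs with h
          · exact (ha0 ⟨i, h⟩).symm
          · exact (ha.eq_zero 0 i (by omega)).symm
        · rfl

theorem interlacingPatterns_pairwiseDisjoint (n : ℕ) (s : Set (Fin n → ℕ)) :
    s.PairwiseDisjoint (interlacingPatterns n) := by
  intro k _ k' _ hne
  refine Finset.disjoint_left.2 fun a ha ha' => hne ?_
  rw [mem_interlacingPatterns] at ha ha'
  funext i
  rw [← ha.2, ← ha'.2]

/-- Removing the top row gives the recursion that `sum_binomialDet_interlacing` proves for the
determinant. -/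
theorem card_interlacingPatterns {n : ℕ} {l : Fin n → ℕ} (hl : Monotone l) :
    ((interlacingPatterns n l).card : ℝ) = binomialDet l := by
  induction n with
  | zero => simp [interlacingPatterns, binomialDet]
  | succ n ih =>
    classical
    have hinj : Function.Injective (consRow l) := fun a b h => by
      funext d i
      exact congrFun (congrFun h (d + 1)) i
    rw [interlacingPatterns, Finset.card_biUnion, ← sum_binomialDet_interlacing l hl]
    · push_cast
      refine Finset.sum_congr rfl fun k hk => ?_
      rw [Finset.card_image_of_injective _ hinj]
      refine ih ?_
      intro i j hij
      rw [Fintype.mem_piFinset] at hk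
      rcases hij.eq_or_lt with rfl | hij
      · exact le_rfl
      · have h1 := (Finset.mem_Ico.1 (hk i)).2
        have h2 := (Finset.mem_Ico.1 (hk j)).1
        have h3 : l i.succ ≤ l j.castSucc := hl (by
          rw [Fin.le_def]; simpa using Fin.lt_def.1 hij)
        omega
    · intro k hk k' hk' hne
      rw [Function.onFun, Finset.disjoint_image hinj]
      exact interlacingPatterns_pairwiseDisjoint n Set.univ (Set.mem_univ k) (Set.mem_univ k') hne

/-- The interlacing triangular arrays with `n` rows whose top row has entries below `M`. -/
def boundedPatterns (n M : ℕ) : Set (ℕ → ℕ → ℕ) :=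
  {a | IsInterlacing n a ∧ ∀ i < n, a 0 i < M}

theorem IsInterlacing.strictMono {n : ℕ} {a : ℕ → ℕ → ℕ} (ha : IsInterlacing n a) :
    StrictMono fun i : Fin n => a 0 i := by
  rcases n with _ | n
  · exact fun i => i.elim0
  · rw [Fin.strictMono_iff_lt_succ]
    intro i
    have := i.2
    have h1 := ha.le 0 i (by omega)
    have h2 := ha.lt 0 i (by omega)
    simp only [Fin.val_castSucc, Fin.val_succ]
    omega

open Classical in
theorem ncard_boundedPatterns (n M : ℕ) :
    ((boundedPatterns n M).ncard : ℝ) =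
      ∑ l ∈ (Fintype.piFinset fun _ : Fin n => Finset.range M).filter StrictMono,
        binomialDet l := by
  have h : boundedPatterns n M =
      (((Fintype.piFinset fun _ : Fin n => Finset.range M).filter StrictMono).biUnion
        (interlacingPatterns n) : Finset (ℕ → ℕ → ℕ)) := by
    ext a
    simp only [boundedPatterns, Set.mem_ofPred_eq, Finset.coe_biUnion, Finset.mem_coe,
      Finset.mem_filter, Fintype.mem_piFinset, Finset.mem_range, Set.mem_iUnion, exists_prop,
      mem_interlacingPatterns]
    constructor
    · rintro ⟨ha, hM⟩
      exact ⟨fun i => a 0 i, ⟨fun i => hM i i.2, ha.strictMono⟩, ha, fun _ => rfl⟩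
    · rintro ⟨l, ⟨hl, -⟩, ha, h0⟩
      exact ⟨ha, fun i hi => (h0 ⟨i, hi⟩).trans_lt (hl _)⟩
  rw [h, Set.ncard_coe_finset, Finset.card_biUnion]
  · push_cast
    refine Finset.sum_congr rfl fun l hl => ?_
    exact card_interlacingPatterns (Finset.mem_filter.1 hl).2.monotone
  · exact fun k _ k' _ hne =>
      interlacingPatterns_pairwiseDisjoint n Set.univ (Set.mem_univ k) (Set.mem_univ k') hne

/-- Cauchy–Schwarz over at most $M^n$ top rows. -/
theorem sq_ncard_boundedPatterns_le (n M : ℕ) :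
    ((boundedPatterns n M).ncard : ℝ) ^ 2 ≤
      (M : ℝ) ^ n * ∑ l ∈ Fintype.piFinset (fun _ : Fin n => Finset.range M),
        binomialDet l ^ 2 := by
  classical
  rw [ncard_boundedPatterns]
  refine sq_sum_le_card_mul_sum_sq.trans ?_
  have hcard : (((Fintype.piFinset fun _ : Fin n => Finset.range M).filter StrictMono).card : ℝ) ≤
      (M : ℝ) ^ n := by
    have := Finset.card_filter_le (Fintype.piFinset fun _ : Fin n => Finset.range M) StrictMono
    rw [Fintype.card_piFinset_const, Finset.card_range] at this
    exact_mod_cast this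
  refine mul_le_mul hcard ?_ (Finset.sum_nonneg fun _ _ => sq_nonneg _) (by positivity)
  exact Finset.sum_le_sum_of_subset_of_nonneg (Finset.filter_subset _ _)
    fun _ _ _ => sq_nonneg _

/-- Sorting $l$ changes only the sign and gives one summand of the count; a repeated entry makes the
determinant vanish. -/
theorem abs_binomialDet_le_ncard {n M : ℕ} {l : Fin n → ℕ} (hl : ∀ i, l i < M) :
    |binomialDet l| ≤ ((boundedPatterns n M).ncard : ℝ) := by
  classical
  by_cases hinj : Function.Injective l
  · have h1 : |binomialDet l| = |binomialDet (l ∘ Tuple.sort l)| :=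
      (Matrix.abs_det_submatrix_equiv_equiv (Tuple.sort l) (Equiv.refl _)
        (Matrix.of fun i j : Fin n => ((l i).choose j : ℝ))).symm
    have hm : Monotone (l ∘ Tuple.sort l) := Tuple.monotone_sort l
    have hs : StrictMono (l ∘ Tuple.sort l) :=
      hm.strictMono_of_injective (hinj.comp (Tuple.sort l).injective)
    rw [h1, abs_of_nonneg (binomialDet_nonneg hm), ncard_boundedPatterns]
    refine Finset.single_le_sum (f := fun l => binomialDet l) (fun k hk => ?_) ?_
    · exact binomialDet_nonneg (Finset.mem_filter.1 hk).2.monotone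
    · simp only [Finset.mem_filter, Fintype.mem_piFinset, Finset.mem_range]
      exact ⟨fun i => hl _, hs⟩
  · have h0 : binomialDet l = 0 := by
      simp only [Function.Injective, not_forall] at hinj
      obtain ⟨i, j, hij, hne⟩ := hinj
      refine Matrix.det_zero_of_row_eq hne ?_
      funext k
      simp [hij]
    rw [h0, abs_zero]
    positivity

theorem sum_binomialDet_sq_le (n M : ℕ) :
    ∑ l ∈ Fintype.piFinset (fun _ : Fin n => Finset.range M), binomialDet l ^ 2 ≤
      (M : ℝ) ^ n * ((boundedPatterns n M).ncard : ℝ) ^ 2 := by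
  have h : ∀ l ∈ Fintype.piFinset (fun _ : Fin n => Finset.range M),
      binomialDet l ^ 2 ≤ ((boundedPatterns n M).ncard : ℝ) ^ 2 := by
    intro l hl
    rw [← sq_abs]
    gcongr
    exact abs_binomialDet_le_ncard fun i => by simpa using Fintype.mem_piFinset.1 hl i
  refine (Finset.sum_le_card_nsmul _ _ _ h).trans ?_
  rw [Fintype.card_piFinset_const, Finset.card_range, nsmul_eq_mul]
  push_cast
  exact le_rfl

/-! ### Asymptotics of superfactorials -/

theorem one_le_succ_mul_log_sub {k : ℕ} (hk : 1 ≤ k) :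
    1 ≤ ((k : ℝ) + 1) * (Real.log (k + 1) - Real.log k) := by
  have hk' : (1 : ℝ) ≤ k := by exact_mod_cast hk
  have h := Real.log_le_sub_one_of_pos (x := (k : ℝ) / (k + 1)) (by positivity)
  rw [Real.log_div (by positivity) (by positivity)] at h
  have h2 : (k : ℝ) / (k + 1) - 1 = -(1 / (k + 1)) := by field_simp; ring
  rw [h2] at h
  have h3 : 1 / ((k : ℝ) + 1) ≤ Real.log (k + 1) - Real.log k := by linarith
  rw [div_le_iff₀ (by positivity)] at h3
  linarith

theorem mul_log_sub_le_one {k : ℕ} (hk : 1 ≤ k) :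
    (k : ℝ) * (Real.log (k + 1) - Real.log k) ≤ 1 := by
  have hk' : (1 : ℝ) ≤ k := by exact_mod_cast hk
  have h := Real.log_le_sub_one_of_pos (x := ((k : ℝ) + 1) / k) (by positivity)
  rw [Real.log_div (by positivity) (by positivity)] at h
  have h2 : ((k : ℝ) + 1) / k - 1 = 1 / k := by field_simp; ring
  rw [h2, le_div_iff₀ (by positivity)] at h
  linarith

theorem log_factorial_le {k : ℕ} (hk : 1 ≤ k) :
    Real.log k.factorial ≤ k * Real.log k - k + Real.log k + 1 := by
  induction k, hk using Nat.le_induction with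
  | base => simp
  | succ k hk ih =>
    rw [Nat.factorial_succ, Nat.cast_mul, Real.log_mul (by positivity) (by positivity)]
    have := one_le_succ_mul_log_sub hk
    push_cast
    nlinarith

theorem le_log_factorial {k : ℕ} (hk : 1 ≤ k) :
    k * Real.log k - k ≤ Real.log k.factorial := by
  have h := Stirling.le_log_factorial_stirling (show k ≠ 0 by omega)
  have h1 : 0 ≤ Real.log k := Real.log_natCast_nonneg k
  have h2 : 0 ≤ Real.log (2 * Real.pi) := Real.log_nonneg (by nlinarith [Real.pi_gt_three])
  linarith

/-- The logarithm of the superfactorial. -/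
noncomputable def logSuperFactorial (n : ℕ) : ℝ :=
  ∑ k ∈ Finset.range n, Real.log k.factorial

/-- The leading term of `logSuperFactorial`. -/
noncomputable def superStirling (x : ℝ) : ℝ := x ^ 2 / 2 * Real.log x - 3 / 4 * x ^ 2

/-- `superStirling` is an antiderivative of $x\log x-x$, so its unit increments follow Stirling's
formula. -/
theorem abs_log_factorial_sub_le (k : ℕ) :
    |Real.log k.factorial - (superStirling (k + 1) - superStirling k)| ≤ Real.log k + 2 := by
  rcases Nat.eq_zero_or_pos k with rfl | hk
  · norm_num [superStirling]
  have h1 := one_le_succ_mul_log_sub hk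
  have h2 := mul_log_sub_le_one hk
  have h3 := log_factorial_le hk
  have h4 := le_log_factorial hk
  have h5 : 0 ≤ Real.log k := Real.log_natCast_nonneg k
  have hk' : (1 : ℝ) ≤ k := by exact_mod_cast hk
  have e : superStirling (k + 1) - superStirling k =
      ((k : ℝ) + 1) ^ 2 / 2 * (Real.log (k + 1) - Real.log k) + (k + 1 / 2) * Real.log k
        - 3 / 2 * k - 3 / 4 := by
    simp only [superStirling]; ring
  set y := Real.log ((k : ℝ) + 1) - Real.log k
  have hy : y ≤ 1 := by nlinarith
  have hlow : ((k : ℝ) + 1) / 2 ≤ ((k : ℝ) + 1) ^ 2 / 2 * y := by nlinarith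
  have hup : ((k : ℝ) + 1) ^ 2 / 2 * y ≤ (k : ℝ) / 2 + 1 + 1 / 2 := by
    have : ((k : ℝ) + 1) ^ 2 / 2 * y = k * (k * y) / 2 + k * y + y / 2 := by ring
    rw [this]
    nlinarith
  rw [abs_le, e]
  constructor <;> linarith

theorem abs_logSuperFactorial_sub_le (n : ℕ) :
    |logSuperFactorial n - superStirling n| ≤ n * (Real.log n + 2) := by
  induction n with
  | zero => simp [logSuperFactorial, superStirling]
  | succ n ih =>
    have h := abs_log_factorial_sub_le n
    have e : logSuperFactorial (n + 1) = logSuperFactorial n + Real.log n.factorial :=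
      Finset.sum_range_succ _ _
    have hlog : Real.log n ≤ Real.log (n + 1) := by
      rcases Nat.eq_zero_or_pos n with rfl | hn
      · simp
      · exact Real.log_le_log (by exact_mod_cast hn) (by linarith)
    have hn : (0 : ℝ) ≤ n := by positivity
    rw [e]
    push_cast
    rw [abs_le] at *
    constructor <;> nlinarith

/-- The factorials fill the blocks $[2r,3r)$ and $[0,r)$ above, and $[r,2r)$ twice below (once in
reverse). -/
theorem log_prod_factorial (r : ℕ) :
    Real.log (r.factorial * ∏ k : Fin r, (((2 * r + k).factorial : ℝ) * (k : ℕ).factorial /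
        ((2 * r - 1 - k).factorial * (r + k).factorial))) =
      Real.log r.factorial + logSuperFactorial (3 * r) - 3 * logSuperFactorial (2 * r) +
        3 * logSuperFactorial r := by
  rw [Real.log_mul (by positivity) (Finset.prod_pos fun _ _ => by positivity).ne',
    Real.log_prod (fun _ _ => by positivity)]
  have h1 : ∀ k : Fin r, Real.log (((2 * r + k).factorial : ℝ) * (k : ℕ).factorial /
        ((2 * r - 1 - k).factorial * (r + k).factorial)) =
      Real.log (2 * r + k).factorial + Real.log (k : ℕ).factorial -
        (Real.log (2 * r - 1 - k).factorial + Real.log (r + k).factorial) := by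
    intro k
    rw [Real.log_div (by positivity) (by positivity), Real.log_mul (by positivity) (by positivity),
      Real.log_mul (by positivity) (by positivity)]
  simp_rw [h1]
  rw [Fin.sum_univ_eq_sum_range (fun k : ℕ =>
    Real.log (2 * r + k).factorial + Real.log k.factorial -
        (Real.log (2 * r - 1 - k).factorial + Real.log (r + k).factorial)) r,
    Finset.sum_sub_distrib, Finset.sum_add_distrib, Finset.sum_add_distrib]
  have h3 : logSuperFactorial (3 * r) = logSuperFactorial (2 * r) +
      ∑ k ∈ Finset.range r, Real.log (2 * r + k).factorial := by
    rw [logSuperFactorial, show 3 * r = 2 * r + r by ring, Finset.sum_range_add]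
    rfl
  have h2 : logSuperFactorial (2 * r) = logSuperFactorial r +
      ∑ k ∈ Finset.range r, Real.log (r + k).factorial := by
    rw [logSuperFactorial, show 2 * r = r + r by ring, Finset.sum_range_add]
    rfl
  have h4 : ∑ k ∈ Finset.range r, Real.log (2 * r - 1 - k).factorial =
      ∑ k ∈ Finset.range r, Real.log (r + k).factorial := by
    rw [← Finset.sum_range_reflect (fun k => Real.log (r + k).factorial)]
    refine Finset.sum_congr rfl fun k hk => ?_
    rw [Finset.mem_range] at hk
    congr 3
    omega
  rw [h4, h3, h2]
  simp only [logSuperFactorial]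
  ring

theorem ncard_boundedPatterns_pos {n M : ℕ} (h : n ≤ M) :
    (0 : ℝ) < (boundedPatterns n M).ncard := by
  have h1 := sum_binomialDet_sq_le n M
  rw [sum_binomialDet_sq h] at h1
  have h2 : (0 : ℝ) < n.factorial * ∏ k : Fin n, (((M + k).factorial : ℝ) * (k : ℕ).factorial /
        ((M - 1 - k).factorial * (n + k).factorial)) :=
    mul_pos (by positivity) (Finset.prod_pos fun _ _ => by positivity)
  refine lt_of_le_of_ne (by positivity) fun h0 => ?_
  rw [← h0] at h1
  simp only [ne_eq, OfNat.ofNat_ne_zero, not_false_eq_true, zero_pow, mul_zero] at h1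
  linarith

theorem abs_log_ncard_boundedPatterns_sub_le {r : ℕ} (hr : 1 ≤ r) :
    |2 * Real.log (boundedPatterns r (2 * r)).ncard -
      (9 / 2 * Real.log 3 - 6 * Real.log 2) * (r : ℝ) ^ 2| ≤ 15 * (r * (Real.log r + 4)) := by
  have hA := ncard_boundedPatterns_pos (show r ≤ 2 * r by omega)
  have h1 := sq_ncard_boundedPatterns_le r (2 * r)
  have h2 := sum_binomialDet_sq_le r (2 * r)
  rw [sum_binomialDet_sq (show r ≤ 2 * r by omega)] at h1 h2
  have hQ : (0 : ℝ) < r.factorial * ∏ k : Fin r, (((2 * r + k).factorial : ℝ) *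
      (k : ℕ).factorial / ((2 * r - 1 - k).factorial * (r + k).factorial)) :=
    mul_pos (by positivity) (Finset.prod_pos fun _ _ => by positivity)
  have hlogQ := log_prod_factorial r
  set Q : ℝ := r.factorial * ∏ k : Fin r, (((2 * r + k).factorial : ℝ) *
      (k : ℕ).factorial / ((2 * r - 1 - k).factorial * (r + k).factorial))
  set A : ℝ := ((boundedPatterns r (2 * r)).ncard : ℝ)
  clear_value Q A
  have hr' : (1 : ℝ) ≤ r := by exact_mod_cast hr
  have hM : (0 : ℝ) < ((2 * r : ℕ) : ℝ) := by push_cast; linarith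
  have h1' := Real.log_le_log (by positivity) h1
  have h2' := Real.log_le_log hQ h2
  rw [Real.log_mul (by positivity) hQ.ne', Real.log_pow, Real.log_pow] at h1'
  rw [Real.log_mul (by positivity) (by positivity), Real.log_pow, Real.log_pow] at h2'
  have s3 := abs_logSuperFactorial_sub_le (3 * r)
  have s2 := abs_logSuperFactorial_sub_le (2 * r)
  have s1 := abs_logSuperFactorial_sub_le r
  have f1 := log_factorial_le hr
  have f2 : 0 ≤ Real.log r.factorial := Real.log_natCast_nonneg _
  push_cast at h1' h2' s3 s2
  have l2 : Real.log (2 * r) = Real.log 2 + Real.log r := Real.log_mul (by norm_num) (by positivity)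
  have l3 : Real.log (3 * r) = Real.log 3 + Real.log r := Real.log_mul (by norm_num) (by positivity)
  have b2 : Real.log 2 ≤ 1 := by
    have := Real.log_le_sub_one_of_pos (x := 2) (by norm_num); linarith
  have b3 : Real.log 3 ≤ 2 := by
    have := Real.log_le_sub_one_of_pos (x := 3) (by norm_num); linarith
  have b1 : 0 ≤ Real.log r := Real.log_natCast_nonneg _
  -- Since $9-3\cdot4+3=0$, the terms $r^2\log r$ and $\frac34r^2$ cancel.
  have e : superStirling (3 * r) - 3 * superStirling (2 * r) + 3 * superStirling r =
      (9 / 2 * Real.log 3 - 6 * Real.log 2) * (r : ℝ) ^ 2 := by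
    simp only [superStirling]
    rw [l2, l3]
    ring
  rw [l2] at h1' h2' s2
  rw [l3] at s3
  have m2 : (r : ℝ) * Real.log 2 ≤ r * 1 := by gcongr
  have m3 : (r : ℝ) * Real.log 3 ≤ r * 2 := by gcongr
  have m1 : 0 ≤ (r : ℝ) * Real.log r := by positivity
  have b1' : Real.log r ≤ r - 1 := Real.log_le_sub_one_of_pos (by positivity)
  rw [abs_le] at *
  rw [← e]
  constructor <;> nlinarith

theorem tendsto_log_ncard_boundedPatterns :
    Tendsto (fun r : ℕ => Real.log (boundedPatterns r (2 * r)).ncard / (r : ℝ) ^ 2) atTop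
      (𝓝 (9 / 4 * Real.log 3 - 3 * Real.log 2)) := by
  have hlog : Tendsto (fun r : ℕ => Real.log r / (r : ℝ)) atTop (𝓝 0) :=
    (Real.isLittleO_log_id_atTop.tendsto_div_nhds_zero).comp tendsto_natCast_atTop_atTop
  have hinv : Tendsto (fun r : ℕ => (4 : ℝ) / r) atTop (𝓝 0) :=
    tendsto_const_div_atTop_nhds_zero_nat 4
  have hbound : Tendsto (fun r : ℕ => 15 / 2 * (Real.log r / (r : ℝ) + 4 / r)) atTop (𝓝 0) := by
    simpa using (hlog.add hinv).const_mul (15 / 2)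
  rw [tendsto_iff_norm_sub_tendsto_zero]
  refine squeeze_zero' (Eventually.of_forall fun _ => norm_nonneg _) ?_ hbound
  filter_upwards [eventually_ge_atTop 1] with r hr
  have h := abs_log_ncard_boundedPatterns_sub_le hr
  have hr' : (0 : ℝ) < r := by exact_mod_cast hr
  have e : Real.log (boundedPatterns r (2 * r)).ncard / (r : ℝ) ^ 2 -
      (9 / 4 * Real.log 3 - 3 * Real.log 2) =
      (2 * Real.log (boundedPatterns r (2 * r)).ncard -
      (9 / 2 * Real.log 3 - 6 * Real.log 2) * (r : ℝ) ^ 2) / (2 * (r : ℝ) ^ 2) := by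
    field_simp
    ring
  rw [e, norm_div, Real.norm_eq_abs, Real.norm_eq_abs, abs_of_pos (by positivity : 0 < 2 * (r : ℝ) ^ 2),
    div_le_iff₀ (by positivity)]
  refine h.trans_eq ?_
  field_simp

/-! ### Vertex potentials of a monotone matrix -/

section Threshold

variable {m : ℕ} {M : Fin m → Fin m → Fin m}

/-- The number of off-diagonal entries at most `t` in the `i`-th row of `M`. -/
def rowCount (M : Fin m → Fin m → Fin m) (t : ℕ) (i : Fin m) : ℕ :=
  (Finset.univ.filter fun j => j ≠ i ∧ (M i j : ℕ) ≤ t).card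

/-- For $i<j$, monotonicity puts columns $0,\dots,j$ except $i$ into the count of row $i$, and
columns $0,\dots,i$ into that of row $j$. With the next lemma, the sign of the two counts minus
$i+j$ tells whether $M_{ij}\le t$. -/
theorem le_rowCount_add_rowCount (hsymm : ∀ i j, i ≠ j → M i j = M j i)
    (hmono : ∀ i j k, i ≠ j → i ≠ k → j ≤ k → M i j ≤ M i k) {i j : Fin m} (hij : i ≠ j) {t : ℕ}
    (ht : (M i j : ℕ) ≤ t) : (i : ℕ) + j + 1 ≤ rowCount M t i + rowCount M t j := by
  wlog h : i < j generalizing i j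
  · have := this hij.symm (by rwa [← hsymm i j hij]) (lt_of_le_of_ne (not_lt.1 h) hij.symm)
    omega
  have h1 : (j : ℕ) ≤ rowCount M t i := by
    have : ((Finset.Iic j).erase i).card = (j : ℕ) := by
      rw [Finset.card_erase_of_mem (Finset.mem_Iic.2 h.le), Fin.card_Iic]; simp
    rw [← this]
    refine Finset.card_le_card fun k hk => ?_
    rw [Finset.mem_erase, Finset.mem_Iic] at hk
    rw [Finset.mem_filter]
    exact ⟨Finset.mem_univ _, hk.1, le_trans (Fin.le_def.1 (hmono i k j hk.1.symm hij hk.2)) ht⟩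
  have h2 : (i : ℕ) + 1 ≤ rowCount M t j := by
    rw [← Fin.card_Iic]
    refine Finset.card_le_card fun k hk => ?_
    rw [Finset.mem_Iic] at hk
    rw [Finset.mem_filter]
    have hkj : k ≠ j := (hk.trans_lt h).ne
    refine ⟨Finset.mem_univ _, hkj,
      le_trans (Fin.le_def.1 (hmono j k i hkj.symm hij.symm hk)) ?_⟩
    rwa [← hsymm i j hij]
  omega

theorem rowCount_add_rowCount_lt (hsymm : ∀ i j, i ≠ j → M i j = M j i)
    (hmono : ∀ i j k, i ≠ j → i ≠ k → j ≤ k → M i j ≤ M i k) {i j : Fin m} (hij : i ≠ j) {t : ℕ}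
    (ht : t < (M i j : ℕ)) : rowCount M t i + rowCount M t j + 1 ≤ (i : ℕ) + j := by
  wlog h : i < j generalizing i j
  · have := this hij.symm (by rwa [← hsymm i j hij]) (lt_of_le_of_ne (not_lt.1 h) hij.symm)
    omega
  have h1 : rowCount M t i + 1 ≤ j := by
    have : ((Finset.Iio j).erase i).card + 1 = (j : ℕ) := by
      rw [Finset.card_erase_add_one (Finset.mem_Iio.2 h), Fin.card_Iio]
    rw [← this]
    refine Nat.succ_le_succ (Finset.card_le_card fun k hk => ?_)
    rw [Finset.mem_filter] at hk
    rw [Finset.mem_erase, Finset.mem_Iio]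
    refine ⟨hk.2.1, not_le.1 fun hjk => ?_⟩
    have := Fin.le_def.1 (hmono i j k hij hk.2.1.symm hjk)
    omega
  have h2 : rowCount M t j ≤ i := by
    rw [← Fin.card_Iio i]
    refine Finset.card_le_card fun k hk => ?_
    rw [Finset.mem_filter] at hk
    rw [Finset.mem_Iio]
    refine not_le.1 fun hik => ?_
    have := Fin.le_def.1 (hmono j i k hij.symm hk.2.1.symm hik)
    rw [hsymm i j hij] at ht
    omega
  omega

/-- A symmetric matrix with monotone rows (off the diagonal) records the positions of the minima
of sums of vertex potentials. -/
theorem exists_potential (hsymm : ∀ i j, i ≠ j → M i j = M j i)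
    (hmono : ∀ i j k, i ≠ j → i ≠ k → j ≤ k → M i j ≤ M i k) :
    ∃ f : Fin m → Fin m → ℝ, ∀ i j k, i ≠ j → k ≠ M i j →
      f i (M i j) + f j (M i j) < f i k + f j k := by
  -- The increments of $f_i+f_j$ are negative before $M_{ij}$ and positive from there on.
  refine ⟨fun i k => ∑ t ∈ Finset.range k, ((rowCount M t i : ℝ) - i), fun i j k hij hk => ?_⟩
  simp only [← Finset.sum_add_distrib]
  rcases lt_or_gt_of_ne hk with h | h
  · rw [← sub_neg, ← Finset.sum_Ico_eq_sub _ (Fin.lt_def.1 h).le]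
    refine Finset.sum_neg (fun t ht => ?_) (Finset.nonempty_Ico.2 (Fin.lt_def.1 h))
    have := rowCount_add_rowCount_lt hsymm hmono hij (Finset.mem_Ico.1 ht).2
    have : (rowCount M t i : ℝ) + rowCount M t j + 1 ≤ (i : ℕ) + (j : ℕ) := by exact_mod_cast this
    linarith
  · rw [← sub_pos, ← Finset.sum_Ico_eq_sub _ (Fin.lt_def.1 h).le]
    refine Finset.sum_pos (fun t ht => ?_) (Finset.nonempty_Ico.2 (Fin.lt_def.1 h))
    have := le_rowCount_add_rowCount hsymm hmono hij (Finset.mem_Ico.1 ht).1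
    have : ((i : ℕ) : ℝ) + (j : ℕ) + 1 ≤ rowCount M t i + rowCount M t j := by exact_mod_cast this
    linarith

end Threshold

/-! ### Monotone systems are strictly metric -/

section Weights

variable {m : ℕ}

/-- The edge weights that equal `b` up to the perturbation `f i k` on the edge `x_i y_k`. -/
def joinWeight (b : ℝ) (f : Fin m → Fin m → ℝ) : Sym2 (Fin m ⊕ Fin m) → ℝ :=
  Sym2.lift ⟨fun u v =>
    match u, v with
    | .inl i, .inr k => b + f i k
    | .inr k, .inl i => b + f i k
    | _, _ => b, by rintro (i | i) (j | j) <;> rfl⟩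

theorem abs_joinWeight_sub_le {b c : ℝ} {f : Fin m → Fin m → ℝ} (hc : 0 ≤ c)
    (hf : ∀ i k, |f i k| ≤ c) (e : Sym2 (Fin m ⊕ Fin m)) : |joinWeight b f e - b| ≤ c := by
  induction e using Sym2.ind with
  | _ u v => rcases u with i | i <;> rcases v with j | j <;> simp [joinWeight, hc, hf]

theorem length_mul_le_sum_map_edges {V : Type*} {G : SimpleGraph V} {w : Sym2 V → ℝ} {c : ℝ}
    (hw : ∀ e, c ≤ w e) {u v : V} (q : G.Walk u v) :
    q.length * c ≤ (q.edges.map w).sum := by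
  induction q with
  | nil => simp
  | @cons x y z h q ih =>
    simp only [SimpleGraph.Walk.length_cons, SimpleGraph.Walk.edges_cons, List.map_cons,
      List.sum_cons]
    push_cast
    linarith [hw s(x, y)]

theorem graphJ_adj_inl_inr (i k : Fin m) : (graphJ m).Adj (Sum.inl i) (Sum.inr k) :=
  ⟨by simp, by simp⟩

theorem graphJ_adj_inr_inl (i k : Fin m) : (graphJ m).Adj (Sum.inr k) (Sum.inl i) :=
  (graphJ_adj_inl_inr i k).symm

theorem walk_eq_of_support_eq {i j k : Fin m} {p : (graphJ m).Walk (Sum.inl i) (Sum.inl j)}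
    (h : p.support = [Sum.inl i, Sum.inr k, Sum.inl j]) :
    p = .cons (graphJ_adj_inl_inr i k) (.cons (graphJ_adj_inr_inl j k) .nil) :=
  SimpleGraph.Walk.ext_support h

end Weights

/-- The middle vertices of a path system determine a symmetric matrix. -/
theorem ConsistentPathSystem.symm_of_support_eq {m : ℕ} (P : ConsistentPathSystem (graphJ m))
    {M : Fin m → Fin m → Fin m} (hM : ∀ i j, i ≠ j →
      (P.path (Sum.inl i) (Sum.inl j)).1.support = [Sum.inl i, Sum.inr (M i j), Sum.inl j])
    (i j : Fin m) (hij : i ≠ j) : M i j = M j i := by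
  have h := congrArg SimpleGraph.Walk.support (P.symm (Sum.inl i) (Sum.inl j))
  rw [SimpleGraph.Walk.support_reverse, hM i j hij, hM j i hij.symm] at h
  simp only [List.reverse_cons, List.reverse_nil, List.nil_append, List.cons_append,
    List.cons.injEq, Sum.inr.injEq, and_true, true_and] at h
  exact h.symm

theorem monotonePathSystems_subset (m : ℕ) :
    monotonePathSystems m ⊆ neighborlyStrictlyMetric (graphJ m) := by
  rintro P ⟨hN, M, hM, hmono⟩
  refine ⟨hN, ?_⟩
  obtain ⟨f, hf⟩ := exists_potential (P.symm_of_support_eq hM) hmono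
  set c : ℝ := ∑ i, ∑ k, |f i k|
  have hc : 0 ≤ c := Finset.sum_nonneg fun _ _ => Finset.sum_nonneg fun _ _ => abs_nonneg _
  have hfc : ∀ i k, |f i k| ≤ c := fun i k =>
    (Finset.single_le_sum (f := fun k => |f i k|) (fun _ _ => abs_nonneg _)
      (Finset.mem_univ k)).trans
    (Finset.single_le_sum (f := fun i => ∑ k, |f i k|)
      (fun _ _ => Finset.sum_nonneg fun _ _ => abs_nonneg _) (Finset.mem_univ i))
  -- $b>5c$ gives $3(b-c)>2(b+c)$ and $2(b-c)>b+c$: fewer edges always win, and only two-edge paths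
  -- between the same $x$'s are left to the potentials.
  set b : ℝ := 5 * c + 1 with hb
  set w := joinWeight b f
  have hw : ∀ e, |w e - b| ≤ c := abs_joinWeight_sub_le hc hfc
  have hlow : ∀ e, b - c ≤ w e := fun e => by have := (abs_le.1 (hw e)).1; linarith
  have hup : ∀ e, w e ≤ b + c := fun e => by have := (abs_le.1 (hw e)).2; linarith
  refine ⟨w, fun e _ => lt_of_lt_of_le (by linarith) (hlow e), ?_⟩
  intro u v q hq
  have hne : q.1 ≠ (P.path u v).1 := fun h => hq (Subtype.ext h)
  by_cases huv : u = v
  · subst huv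
    exact absurd ((SimpleGraph.Path.loop_eq q).trans (SimpleGraph.Path.loop_eq _).symm) hq
  have hlen := length_mul_le_sum_map_edges hlow q.1
  by_cases hadj : (graphJ m).Adj u v
  · rw [hN u v hadj] at hne ⊢
    have h2 : 2 ≤ q.1.length := by
      revert hne
      generalize q.1 = q
      intro hne
      rcases q with _ | ⟨h, _ | ⟨h', q⟩⟩
      · exact absurd rfl huv
      · exact absurd rfl hne
      · simp
    have h2' : (2 : ℝ) ≤ q.1.length := by exact_mod_cast h2
    have : (2 : ℝ) * (b - c) ≤ q.1.length * (b - c) := by gcongr; linarith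
    have := hup s(u, v)
    simp only [SimpleGraph.Adj.toWalk, SimpleGraph.Walk.edges_cons, SimpleGraph.Walk.edges_nil,
      List.map_cons, List.map_nil, List.sum_cons, List.sum_nil]
    linarith
  · rcases u with i | i
    swap
    · exact absurd ⟨huv, by simp⟩ hadj
    rcases v with j | j
    swap
    · exact absurd ⟨huv, by simp⟩ hadj
    have hij : i ≠ j := fun h => huv (congrArg _ h)
    have hP := walk_eq_of_support_eq (hM i j hij)
    rw [hP] at hne ⊢
    have e1 : ∀ i j k : Fin m, (((SimpleGraph.Walk.cons (graphJ_adj_inl_inr i k)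
        (.cons (graphJ_adj_inr_inl j k) .nil)).edges).map w).sum = 2 * b + (f i k + f j k) := by
      intro i j k
      simp [w, joinWeight]
      ring
    rw [e1]
    by_cases h3 : 3 ≤ q.1.length
    · have h3' : (3 : ℝ) ≤ q.1.length := by exact_mod_cast h3
      have : (3 : ℝ) * (b - c) ≤ q.1.length * (b - c) := by gcongr; linarith
      have := (abs_le.1 (hfc i (M i j))).2
      have := (abs_le.1 (hfc j (M i j))).2
      linarith
    · clear hlen hP
      revert hne h3
      generalize q.1 = q
      intro hne h3
      rcases q with _ | ⟨h, _ | ⟨h', _ | ⟨h'', q⟩⟩⟩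
      · exact absurd rfl huv
      · exact absurd h hadj
      · rename_i z
        rcases z with z | z
        · exact absurd ⟨rfl, rfl⟩ h.2
        · rw [e1]
          have hz : z ≠ M i j := by
            rintro rfl
            exact hne rfl
          linarith [hf i j z hij hz]
      · simp at h3

/-! ### Path systems from symmetric matrices -/

/-- The vertices of the path from `u` to `v` in the path system of `graphJ m` given by `M`. -/
def twoStepSupport {m : ℕ} (M : Fin m → Fin m → Fin m) :
    Fin m ⊕ Fin m → Fin m ⊕ Fin m → List (Fin m ⊕ Fin m)
  | .inl i, .inl j => if i = j then [.inl i] else [.inl i, .inr (M i j), .inl j]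
  | .inr i, .inr j => if i = j then [.inr i] else [.inr i, .inr j]
  | u, v => [u, v]

theorem exists_path_twoStepSupport {m : ℕ} (M : Fin m → Fin m → Fin m) (u v : Fin m ⊕ Fin m) :
    ∃ p : (graphJ m).Path u v, p.1.support = twoStepSupport M u v := by
  by_cases huv : u = v
  · subst huv
    refine ⟨.nil, ?_⟩
    rcases u with i | i <;> simp [twoStepSupport]
  by_cases hadj : (graphJ m).Adj u v
  · refine ⟨.singleton hadj, ?_⟩
    rcases u with i | i <;> rcases v with j | j
    · exact absurd ⟨rfl, rfl⟩ hadj.2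
    · rfl
    · rfl
    · have : i ≠ j := fun h => huv (congrArg _ h)
      simp [twoStepSupport, this, SimpleGraph.Path.singleton]
  · rcases u with i | i
    swap
    · exact absurd ⟨huv, by simp⟩ hadj
    rcases v with j | j
    swap
    · exact absurd ⟨huv, by simp⟩ hadj
    have hij : i ≠ j := fun h => huv (congrArg _ h)
    refine ⟨⟨.cons (graphJ_adj_inl_inr i (M i j)) (.cons (graphJ_adj_inr_inl j (M i j)) .nil),
      ?_⟩, ?_⟩
    · rw [SimpleGraph.Walk.isPath_def]
      simp [hij]
    · simp [twoStepSupport, hij]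

theorem exists_twoStep_system {m : ℕ} {M : Fin m → Fin m → Fin m}
    (hsymm : ∀ i j, i ≠ j → M i j = M j i) :
    ∃ P : ConsistentPathSystem (graphJ m), P.IsNeighborly ∧ ∀ i j, i ≠ j →
      (P.path (Sum.inl i) (Sum.inl j)).1.support =
        [Sum.inl i, Sum.inr (M i j), Sum.inl j] := by
  choose p hp using exists_path_twoStepSupport M
  refine ⟨⟨p, fun u v => ?_, fun u v a ha => ?_⟩, fun u v h => ?_, fun i j hij => ?_⟩
  · refine SimpleGraph.Walk.ext_support ?_
    rw [SimpleGraph.Walk.support_reverse, hp, hp]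
    rcases u with i | i <;> rcases v with j | j <;> simp only [twoStepSupport] <;>
      first
      | rfl
      | (by_cases hij : i = j
         · simp [hij]
         · simp [hij, Ne.symm hij, hsymm i j])
  · refine SimpleGraph.Walk.ext_support ?_
    rw [SimpleGraph.Walk.support_append, hp, hp, hp]
    rw [hp] at ha
    rcases u with i | i <;> rcases v with j | j <;> simp only [twoStepSupport] at ha ⊢ <;>
      (try by_cases hij : i = j) <;> simp_all <;>
      rcases ha with rfl | rfl | rfl <;> simp_all [eq_comm]
  · refine SimpleGraph.Walk.ext_support ?_
    rw [hp]
    rcases u with i | i <;> rcases v with j | j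
    · exact absurd ⟨rfl, rfl⟩ h.2
    · rfl
    · rfl
    · have : i ≠ j := fun h' => h.1 (congrArg _ h')
      simp [twoStepSupport, this, SimpleGraph.Adj.toWalk]
  · rw [hp]
    simp [twoStepSupport, hij]

theorem ConsistentPathSystem.eq_of_support_eq {m : ℕ} {P Q : ConsistentPathSystem (graphJ m)}
    (hP : P.IsNeighborly) (hQ : Q.IsNeighborly)
    (h : ∀ i j, i ≠ j → (P.path (Sum.inl i) (Sum.inl j)).1.support =
      (Q.path (Sum.inl i) (Sum.inl j)).1.support) : P = Q := by
  refine ConsistentPathSystem.ext (funext fun u => funext fun v => ?_)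
  by_cases huv : u = v
  · subst huv
    exact (SimpleGraph.Path.loop_eq _).trans (SimpleGraph.Path.loop_eq _).symm
  by_cases hadj : (graphJ m).Adj u v
  · exact Subtype.ext ((hP u v hadj).trans (hQ u v hadj).symm)
  · rcases u with i | i
    swap
    · exact absurd ⟨huv, by simp⟩ hadj
    rcases v with j | j
    swap
    · exact absurd ⟨huv, by simp⟩ hadj
    exact Subtype.ext (SimpleGraph.Walk.ext_support (h i j fun h => huv (congrArg _ h)))

/-- Comparing `Set.ncard` along an inclusion needs the larger set finite, as infinite sets have
`ncard` 0. -/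
instance ConsistentPathSystem.finite {V : Type*} [Finite V] (G : SimpleGraph V) :
    Finite (ConsistentPathSystem G) := by
  classical
  have := Fintype.ofFinite V
  exact Finite.of_injective (fun P : ConsistentPathSystem G => P.path)
    fun _ _ h => ConsistentPathSystem.ext h

/-! ### Monotone matrices as interlacing patterns -/

section Pattern

variable {r : ℕ}

/-- The entries of `M` above the diagonal, made strictly increasing. -/
def patternOf (M : Fin (r + 1) → Fin (r + 1) → Fin (r + 1)) (d i : ℕ) : ℕ :=
  if h : d + i < r then (M ⟨i, by omega⟩ ⟨i + d + 1, by omega⟩ : ℕ) + i else 0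

theorem patternOf_of_lt (M : Fin (r + 1) → Fin (r + 1) → Fin (r + 1)) {d i : ℕ} (h : d + i < r) :
    patternOf M d i = (M ⟨i, by omega⟩ ⟨i + d + 1, by omega⟩ : ℕ) + i :=
  dif_pos h

theorem patternOf_congr {M M' : Fin (r + 1) → Fin (r + 1) → Fin (r + 1)}
    (h : ∀ i j, i ≠ j → M i j = M' i j) : patternOf M = patternOf M' := by
  funext d i
  simp only [patternOf]
  split_ifs with hd
  · rw [h _ _ (by rw [Ne, Fin.mk.injEq]; omega)]
  · rfl

/-- Row monotonicity gives the weak inequality. Column monotonicity, from symmetry, becomes strict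
through the shift by $i$. Since $M_{ij}\le r$ and $i<r$, the top row stays below $2r$. -/
theorem patternOf_mem {M : Fin (r + 1) → Fin (r + 1) → Fin (r + 1)}
    (hsymm : ∀ i j, i ≠ j → M i j = M j i)
    (hmono : ∀ i j k, i ≠ j → i ≠ k → j ≤ k → M i j ≤ M i k) :
    patternOf M ∈ boundedPatterns r (2 * r) := by
  refine ⟨⟨fun d i h => dif_neg (by omega), fun d i h => ?_, fun d i h => ?_⟩, fun i h => ?_⟩
  · rw [patternOf_of_lt M (by omega), patternOf_of_lt M (by omega)]
    have := Fin.le_def.1 (hmono ⟨i, by omega⟩ ⟨i + d + 1, by omega⟩ ⟨i + (d + 1) + 1, by omega⟩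
      (by rw [Ne, Fin.mk.injEq]; omega) (by rw [Ne, Fin.mk.injEq]; omega)
      (by rw [Fin.le_def]; simp only; omega))
    omega
  · rw [patternOf_of_lt M (by omega), patternOf_of_lt M (by omega)]
    have := Fin.le_def.1 (hmono ⟨i + (d + 1) + 1, by omega⟩ ⟨i, by omega⟩ ⟨i + 1, by omega⟩
      (by rw [Ne, Fin.mk.injEq]; omega) (by rw [Ne, Fin.mk.injEq]; omega)
      (by rw [Fin.le_def]; simp only; omega))
    rw [hsymm _ ⟨i, _⟩ (by rw [Ne, Fin.mk.injEq]; omega),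
      hsymm _ ⟨i + 1, _⟩ (by rw [Ne, Fin.mk.injEq]; omega)] at this
    have e : (⟨i + 1 + d + 1, by omega⟩ : Fin (r + 1)) = ⟨i + (d + 1) + 1, by omega⟩ := by
      rw [Fin.mk.injEq]; omega
    rw [e]
    omega
  · rw [patternOf_of_lt M (by omega)]
    have := (M ⟨i, by omega⟩ ⟨i + 0 + 1, by omega⟩).2
    omega

theorem eq_of_patternOf_eq {M M' : Fin (r + 1) → Fin (r + 1) → Fin (r + 1)}
    (hsymm : ∀ i j, i ≠ j → M i j = M j i) (hsymm' : ∀ i j, i ≠ j → M' i j = M' j i)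
    (h : patternOf M = patternOf M') {i j : Fin (r + 1)} (hij : i ≠ j) : M i j = M' i j := by
  wlog hlt : i < j generalizing i j
  · rw [hsymm i j hij, hsymm' i j hij]
    exact this hij.symm (lt_of_le_of_ne (not_lt.1 hlt) hij.symm)
  have h1 := congrFun (congrFun h (j - i - 1)) i
  have hlt' := Fin.lt_def.1 hlt
  have hj := j.2
  rw [patternOf_of_lt M (by omega), patternOf_of_lt M' (by omega)] at h1
  have e : (⟨i + (j - i - 1) + 1, by omega⟩ : Fin (r + 1)) = j := by
    rw [Fin.ext_iff]; simp only; omega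
  rw [e] at h1
  exact Fin.ext (by simpa using h1)

variable {a : ℕ → ℕ → ℕ}

theorem le_of_mem_boundedPatterns {N : ℕ} (ha : a ∈ boundedPatterns r N) {d i : ℕ} (h : d + i < r) :
    i ≤ a d i := by
  induction i generalizing d with
  | zero => exact Nat.zero_le _
  | succ i ih =>
    have h1 := ha.1.lt d i (by omega)
    have h2 := ih (d := d + 1) (by omega)
    omega

/-- The top row increases strictly to at most $2r-1$, and each lower entry is less than the one up
and to the right. So subtracting $i$ returns values in $\{0,\dots,r\}$. -/
theorem le_add_of_mem_boundedPatterns (ha : a ∈ boundedPatterns r (2 * r)) {d i : ℕ}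
    (h : d + i < r) : a d i ≤ i + r := by
  induction d generalizing i with
  | zero =>
    obtain ⟨k, hk⟩ : ∃ k, i + k + 1 = r := ⟨r - i - 1, by omega⟩
    clear h
    induction k generalizing i with
    | zero => have := ha.2 i (by omega); omega
    | succ k ih =>
      have h1 := ih (i := i + 1) (by omega)
      have h2 := ha.1.le 0 i (by omega)
      have h3 := ha.1.lt 0 i (by omega)
      omega
  | succ d ih =>
    have h1 := ih (i := i + 1) (by omega)
    have h2 := ha.1.lt d i (by omega)
    omega

/-- The entry in row `i` and column `j > i` of the matrix encoded by the pattern `a`. -/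
def patternEntry (a : ℕ → ℕ → ℕ) (i j : ℕ) : ℕ := a (j - i - 1) i - i

theorem patternEntry_le_right (ha : a ∈ boundedPatterns r (2 * r)) {i j k : ℕ} (hij : i < j)
    (hjk : j ≤ k) (hk : k ≤ r) : patternEntry a i j ≤ patternEntry a i k := by
  induction k, hjk using Nat.le_induction with
  | base => exact le_rfl
  | succ k hjk ih =>
    refine (ih (by omega)).trans (Nat.sub_le_sub_right ?_ i)
    have := ha.1.le (k - i - 1) i (by omega)
    rwa [show k + 1 - i - 1 = k - i - 1 + 1 by omega]

theorem patternEntry_le_left (ha : a ∈ boundedPatterns r (2 * r)) {i j k : ℕ} (hij : i ≤ j)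
    (hjk : j < k) (hk : k ≤ r) : patternEntry a i k ≤ patternEntry a j k := by
  induction j, hij using Nat.le_induction with
  | base => exact le_rfl
  | succ j hij ih =>
    refine (ih (by omega)).trans ?_
    have h1 := ha.1.lt (k - (j + 1) - 1) j (by omega)
    simp only [patternEntry]
    rw [show k - j - 1 = k - (j + 1) - 1 + 1 by omega]
    omega

theorem exists_matrix_of_pattern (ha : a ∈ boundedPatterns r (2 * r)) :
    ∃ M : Fin (r + 1) → Fin (r + 1) → Fin (r + 1), (∀ i j, i ≠ j → M i j = M j i) ∧
      (∀ i j k, i ≠ j → i ≠ k → j ≤ k → M i j ≤ M i k) ∧ patternOf M = a := by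
  -- The cap $r$ only serves to land in `Fin (r + 1)` on the diagonal too; off it, the cap is never
  -- active.
  refine ⟨fun i j => ⟨min r (patternEntry a (min i j : ℕ) (max i j : ℕ)), by omega⟩,
    fun i j _ => ?_, fun i j k hij hik hjk => ?_, ?_⟩
  · simp only [min_comm (i : ℕ), max_comm (i : ℕ)]
  · rw [Fin.le_def] at hjk ⊢
    rw [Ne, Fin.ext_iff] at hij hik
    have hi := i.2
    have hj := j.2
    have hk := k.2
    refine min_le_min le_rfl ?_
    rcases lt_or_ge (k : ℕ) i with h | h
    · rw [min_eq_right (by omega), min_eq_right (by omega), max_eq_left (by omega),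
        max_eq_left (by omega)]
      exact patternEntry_le_left ha hjk h (by omega)
    rcases lt_or_ge (i : ℕ) j with h' | h'
    · rw [min_eq_left (by omega), min_eq_left (by omega), max_eq_right (by omega),
        max_eq_right (by omega)]
      exact patternEntry_le_right ha h' hjk (by omega)
    · rw [min_eq_right (by omega), min_eq_left (by omega), max_eq_left (by omega),
        max_eq_right (by omega)]
      -- Crossing the diagonal, $j<i<k$: compare $(j,i)$ with $(j,k)$, then with $(i,k)$.
      exact (patternEntry_le_right ha (by omega) h (by omega)).trans
        (patternEntry_le_left ha h' (by omega) (by omega))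
  · funext d i
    by_cases h : d + i < r
    · rw [patternOf_of_lt _ h]
      have h1 := le_of_mem_boundedPatterns ha h
      have h2 := le_add_of_mem_boundedPatterns ha h
      simp only [patternEntry]
      rw [min_eq_left (show i ≤ i + d + 1 by omega), max_eq_right (show i ≤ i + d + 1 by omega),
        show i + d + 1 - i - 1 = d by omega]
      omega
    · rw [ha.1.eq_zero d i (by omega)]
      exact dif_neg h

end Pattern

/-! ### The count of monotone systems and the final estimates -/

theorem ncard_monotonePathSystems_succ (r : ℕ) :
    (monotonePathSystems (r + 1)).ncard = (boundedPatterns r (2 * r)).ncard := by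
  refine Set.ncard_congr (fun P hP => patternOf hP.2.choose) (fun P hP => ?_)
    (fun P Q hP hQ h => ?_) (fun a ha => ?_)
  · have h := hP.2.choose_spec
    exact patternOf_mem (P.symm_of_support_eq h.1) h.2
  · have h1 := hP.2.choose_spec
    have h2 := hQ.2.choose_spec
    refine ConsistentPathSystem.eq_of_support_eq hP.1 hQ.1 fun i j hij => ?_
    rw [h1.1 i j hij, h2.1 i j hij,
      eq_of_patternOf_eq (P.symm_of_support_eq h1.1) (Q.symm_of_support_eq h2.1) h hij]
  · obtain ⟨M, hsymm, hmono, rfl⟩ := exists_matrix_of_pattern ha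
    obtain ⟨P, hN, hP⟩ := exists_twoStep_system hsymm
    have hmem : P ∈ monotonePathSystems (r + 1) := ⟨hN, M, hP, hmono⟩
    -- The chosen matrix may differ from `M` on the diagonal, which `patternOf` ignores.
    refine ⟨P, hmem, patternOf_congr fun i j hij => ?_⟩
    have h := hmem.2.choose_spec.1 i j hij
    rw [hP i j hij] at h
    simp only [List.cons.injEq, Sum.inr.injEq, and_true, true_and] at h
    exact h.symm

theorem ncard_monotonePathSystems_zero : (monotonePathSystems 0).ncard = 1 := by
  obtain ⟨P, hN, -⟩ := exists_twoStep_system (m := 0) (M := fun i => i.elim0) fun i => i.elim0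
  rw [Set.ncard_eq_one]
  refine ⟨P, Set.eq_singleton_iff_unique_mem.2
    ⟨⟨hN, fun i => i.elim0, fun i => i.elim0, fun i => i.elim0⟩, fun Q hQ => ?_⟩⟩
  exact ConsistentPathSystem.eq_of_support_eq hQ.1 hN fun i => i.elim0

theorem ncard_monotonePathSystems_pos (m : ℕ) :
    (0 : ℝ) < ((monotonePathSystems m).ncard : ℝ) := by
  rcases m with _ | r
  · simp [ncard_monotonePathSystems_zero]
  · rw [ncard_monotonePathSystems_succ]
    exact ncard_boundedPatterns_pos (by omega)

theorem tendsto_log_ncard_monotonePathSystems :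
    Tendsto (fun m : ℕ => Real.log (monotonePathSystems m).ncard / (m : ℝ) ^ 2) atTop
      (𝓝 (9 / 4 * Real.log 3 - 3 * Real.log 2)) := by
  rw [← tendsto_add_atTop_iff_nat 1]
  have h := tendsto_log_ncard_boundedPatterns.mul ((tendsto_natCast_div_add_atTop (1 : ℝ)).pow 2)
  rw [one_pow, mul_one] at h
  refine h.congr' ?_
  filter_upwards [eventually_ge_atTop 1] with r hr
  have hr' : (0 : ℝ) < r := by exact_mod_cast hr
  rw [ncard_monotonePathSystems_succ]
  push_cast
  field_simp

/-- From $2^{19}<3^{12}$ and $3^{41}<2^{65}$; these convergents give $0.1406<\alpha<0.1418$. -/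
theorem logb_two_three_bounds : 19 / 12 < Real.logb 2 3 ∧ Real.logb 2 3 < 65 / 41 := by
  have h2 : 0 < Real.log 2 := Real.log_pos (by norm_num)
  have e : Real.logb 2 3 = Real.log 3 / Real.log 2 := rfl
  rw [e, lt_div_iff₀ h2, div_lt_iff₀ h2]
  have a1 : Real.log ((2 : ℝ) ^ 19) < Real.log ((3 : ℝ) ^ 12) :=
    Real.log_lt_log (by norm_num) (by norm_num)
  have a2 : Real.log ((3 : ℝ) ^ 41) < Real.log ((2 : ℝ) ^ 65) :=
    Real.log_lt_log (by norm_num) (by norm_num)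
  rw [Real.log_pow, Real.log_pow] at a1 a2
  push_cast at a1 a2
  constructor <;> linarith

theorem exists_ncard_monotonePathSystems_eq {α : ℝ} (hα : α = 3 / 16 * (3 * Real.logb 2 3 - 4)) :
    ∃ ε : ℕ → ℝ, Tendsto ε atTop (𝓝 0) ∧ ∀ n : ℕ, Even n →
      ((monotonePathSystems (n / 2)).ncard : ℝ) =
        (2 : ℝ) ^ (α * (n : ℝ) ^ 2 * (1 + ε n)) := by
  have h2 : 0 < Real.log 2 := Real.log_pos (by norm_num)
  have hα0 : 0 < α := by
    have := logb_two_three_bounds.1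
    rw [hα]
    linarith
  have hL : 9 / 4 * Real.log 3 - 3 * Real.log 2 = 4 * α * Real.log 2 := by
    have : Real.logb 2 3 * Real.log 2 = Real.log 3 := div_mul_cancel₀ _ h2.ne'
    rw [hα, ← this]
    ring
  -- The factor 4 is $n^2/m^2$ for $n=2m$. At $n=0$ division by zero makes $\varepsilon=-1$,
  -- harmless because the exponent is 0.
  refine ⟨fun n => Real.log (monotonePathSystems (n / 2)).ncard / (((n / 2 : ℕ) : ℝ) ^ 2) /
    (4 * α * Real.log 2) - 1, ?_, ?_⟩
  · have h := tendsto_log_ncard_monotonePathSystems.comp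
      (Nat.tendsto_div_const_atTop (show 2 ≠ 0 by norm_num))
    have h3 := (h.div_const (4 * α * Real.log 2)).sub_const 1
    rw [hL, div_self (by positivity), sub_self] at h3
    exact h3
  · rintro n ⟨m, rfl⟩
    beta_reduce
    rw [show (m + m) / 2 = m by omega]
    rcases Nat.eq_zero_or_pos m with rfl | hm
    · simp [ncard_monotonePathSystems_zero]
    · have hm' : (0 : ℝ) < m := by exact_mod_cast hm
      rw [Real.rpow_def_of_pos (by norm_num)]
      refine (Real.exp_log (ncard_monotonePathSystems_pos m)).symm.trans ?_
      congr 1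
      push_cast
      field_simp
      ring

theorem proposition5p10 (α : ℝ) (hα : α = 3 / 16 * (3 * Real.logb 2 3 - 4)) :
    |α - 0.141| < 0.001 ∧
    (∃ ε : ℕ → ℝ, Tendsto ε atTop (𝓝 0) ∧ ∀ n : ℕ, Even n →
      ((monotonePathSystems (n / 2)).ncard : ℝ) =
        (2 : ℝ) ^ (α * (n : ℝ) ^ 2 * (1 + ε n))) ∧
    (∃ ε : ℕ → ℝ, Tendsto ε atTop (𝓝 0) ∧ ∀ n : ℕ, Even n →
      ((neighborlyStrictlyMetric (graphJ (n / 2))).ncard : ℝ) ≥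
        (2 : ℝ) ^ (α * (n : ℝ) ^ 2 * (1 + ε n))) := by
  refine ⟨?_, exists_ncard_monotonePathSystems_eq hα, ?_⟩
  · obtain ⟨h1, h2⟩ := logb_two_three_bounds
    rw [hα, abs_lt]
    constructor <;> norm_num <;> linarith
  · obtain ⟨ε, hε, h⟩ := exists_ncard_monotonePathSystems_eq hα
    refine ⟨ε, hε, fun n hn => ?_⟩
    rw [← h n hn, ge_iff_le, Nat.cast_le]
    exact Set.ncard_le_ncard (monotonePathSystems_subset _) (Set.toFinite _)
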